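/- Consider the linear regression model $y_t = x_t'\theta + \epsilon_t$ ($1\le t\le n$), where $\theta\in\mathbb{R}^k$ with $k\ge 1$ is unknown, the nonstochastic regressors $x_t\in\mathbb{R}^k$ satisfy $n^{-1}\sum_{t=1}^n x_t x_t' \to Q$ as $n\to\infty$ for a positive definite matrix $Q$, and the errors $\epsilon_t$ are independent and identically distributed with mean zero and finite variance. Assume that $\epsilon_t$ has a density $f$ that is differentiable with an absolutely continuous derivative $f'$ and satisfies $$0<\int_{-\infty}^{\infty}\left(\frac{f'(u)}{f(u)}\right)^2 f(u)\,du<\infty .$$ Let $P_{n,\theta}$ be the distribution of the sample $(y_1,\dots,y_n)'$ and $E_{n,\theta}$ the corresponding expectation. For $\theta\in\mathbb{R}^k$ let $r(\theta)\in\{0,1\}^k$ have components $r_i(\theta)=0$ if $\theta_i=0$ and $r_i(\theta)=1$ if $\theta_i\neq 0$. Let $\hat\theta=\hat\theta_n(y_1,\dots,y_n)$ be an arbitrary (measurable) estimator for $\theta$ that satisfies the sparsity-type condition $$P_{n,\theta}\bigl(r(\hat\theta)\le r(\theta)\bigr)\to 1\quad\text{as } n\to\infty,\ \text{for every } \theta\in\mathbb{R}^k,$$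 where $\le$ is understood componentwise. Then the maximal scaled mean squared error of $\hat\theta$ diverges to infinity: $$\sup_{\theta\in\mathbb{R}^k}E_{n,\theta}\bigl[n(\hat\theta-\theta)'(\hat\theta-\theta)\bigr]\to\infty\quad\text{as } n\to\infty .$$ More generally, for every nonnegative loss function $l:\mathbb{R}^k\to\mathbb{R}$, $$\sup_{\theta\in\mathbb{R}^k}E_{n,\theta}\,l\bigl(n^{1/2}(\hat\theta-\theta)\bigr)\to\sup_{s\in\mathbb{R}^k}l(s)\quad\text{as } n\to\infty ,$$ as a limit in $[0,\infty]$. In particular, if $l$ is unbounded, then the maximal risk associated with $l$ diverges to infinity as $n\to\infty$. -/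

import Mathlib

open MeasureTheory Filter Topology
open scoped ENNReal

noncomputable section

namespace SparseRegression

/-- The law on `ℝ` of a single error with Lebesgue density `f`. -/
def errorLaw (f : ℝ → ℝ) : Measure ℝ :=
  volume.withDensity (fun u => ENNReal.ofReal (f u))

/-- The information `∫ ((df/dx) / f) ^ 2 f dx` of `f`, as an element of `[0, ∞]`.
(For a differentiable `f ≥ 0`, the derivative vanishes wherever `f` does, and the integrand is `0`
at such points.) -/
def fisherInformation (f : ℝ → ℝ) : ℝ≥0∞ :=
  ∫⁻ u, ENNReal.ofReal ((deriv f u / f u) ^ 2 * f u)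

/-- The assumptions on the error density: `f` is a probability density on `ℝ` with mean zero and
finite variance; it is differentiable, its derivative is absolutely continuous (on every compact
interval), and its information is positive and finite. -/
structure IsErrorDensity (f : ℝ → ℝ) : Prop where
  nonneg : ∀ u, 0 ≤ f u
  lintegral_eq_one : ∫⁻ u, ENNReal.ofReal (f u) = 1
  finite_variance : MemLp (fun u : ℝ => u) 2 (errorLaw f)
  mean_zero : ∫ u, u ∂(errorLaw f) = 0
  differentiable : Differentiable ℝ f
  deriv_absolutelyContinuous : ∀ a b : ℝ, AbsolutelyContinuousOnInterval (deriv f) a b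
  information_pos : 0 < fisherInformation f
  information_lt_top : fisherInformation f < ∞

/-- The distribution `P_{n,θ}` of the sample `(y_1, …, y_n)`, where `y_t = x_t' θ + ε_t` and
`ε_1, …, ε_n` are i.i.d. with density `f`. The regressors are numbered from `0`. -/
def sampleLaw {k : ℕ} (f : ℝ → ℝ) (x : ℕ → EuclideanSpace ℝ (Fin k)) (n : ℕ)
    (θ : EuclideanSpace ℝ (Fin k)) : Measure (Fin n → ℝ) :=
  (Measure.pi (fun _ : Fin n => errorLaw f)).map
    (fun ε t => inner ℝ (x (t : ℕ)) θ + ε t)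

/-- The matrix `n⁻¹ ∑_{t = 1}^n x_t x_t'`. -/
def designMatrix {k : ℕ} (x : ℕ → EuclideanSpace ℝ (Fin k)) (n : ℕ) :
    Matrix (Fin k) (Fin k) ℝ :=
  (n : ℝ)⁻¹ • ∑ t ∈ Finset.range n, Matrix.vecMulVec (x t).ofLp (x t).ofLp

/-- The vector `r(θ)`, with `r_i(θ) = 0` if `θ_i = 0` and `r_i(θ) = 1` if `θ_i ≠ 0`. -/
def r {k : ℕ} (θ : EuclideanSpace ℝ (Fin k)) : Fin k → ℝ :=
  fun i => if θ i = 0 then 0 else 1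

/-- The sparsity-type condition: `P_{n,θ}(r(θ̂) ≤ r(θ)) → 1` for every `θ`, where `≤` is the
componentwise order on `Fin k → ℝ`. -/
def SparsityTypeCondition {k : ℕ} (f : ℝ → ℝ) (x : ℕ → EuclideanSpace ℝ (Fin k))
    (θhat : (n : ℕ) → (Fin n → ℝ) → EuclideanSpace ℝ (Fin k)) : Prop :=
  ∀ θ : EuclideanSpace ℝ (Fin k),
    Tendsto (fun n : ℕ => sampleLaw f x n θ {y | r (θhat n y) ≤ r θ}) atTop (𝓝 1)

/-- The maximal risk `sup_θ E_{n,θ} l(n^{1/2} (θ̂ - θ))` in `[0, ∞]`, for a nonnegative loss `l`. -/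
def maximalRisk {k : ℕ} (f : ℝ → ℝ) (x : ℕ → EuclideanSpace ℝ (Fin k))
    (θhat : (n : ℕ) → (Fin n → ℝ) → EuclideanSpace ℝ (Fin k))
    (l : EuclideanSpace ℝ (Fin k) → ℝ) (n : ℕ) : ℝ≥0∞ :=
  ⨆ θ : EuclideanSpace ℝ (Fin k),
    ∫⁻ y, ENNReal.ofReal (l (Real.sqrt n • (θhat n y - θ))) ∂(sampleLaw f x n θ)

end SparseRegression

end

/-! At `θ = 0` sparsity forces the estimator to be exactly `0` with probability tending to one. The
laws at `-s / √n` are contiguous to the law at `0`, so the same holds along these local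
alternatives. There the scaled error is exactly `s` whenever the estimator vanishes, so the maximal
risk is asymptotically at least `l s`, for each `s`. The supremum of `l` is a trivial upper bound.

Contiguity (`tendsto_pi_translate_zero`) needs no expansion of the likelihood. The ratio for a shift
`a` is cut off where it exceeds 4. The truncated ratio has second moment at most `1 + 9 I a ^ 2`,
with `I` the information, so the product over the sample stays bounded when `∑ a_t ^ 2` does. The
discarded mass is `o(a ^ 2)` by `exists_setLIntegral_sqrtIncrement_le`, so its sum tends to zero
when the shifts are also uniformly small. Both estimates come from the increments of `√f`, and
`pi_le_of_truncated_density` combines them. -/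

namespace SparseRegression

open Set

/-! ### Change of measure on finite products -/

/-- A truncated change of measure on a finite product: if `ν i` has density `L i` with respect to
`μ i` on `B i`, then `ν`-probabilities are controlled by `μ`-probabilities. -/
theorem pi_le_of_truncated_density {ι : Type*} [Fintype ι] {X : ι → Type*}
    [∀ i, MeasurableSpace (X i)] (μ ν : ∀ i, Measure (X i))
    [∀ i, IsProbabilityMeasure (μ i)] [∀ i, IsProbabilityMeasure (ν i)]
    (B : ∀ i, Set (X i)) (hB : ∀ i, MeasurableSet (B i))
    (L : ∀ i, X i → ℝ≥0∞) (hL : ∀ i, Measurable (L i))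
    (hLν : ∀ i, (ν i).restrict (B i) = (μ i).withDensity (L i))
    (A : Set (∀ i, X i)) (hA : MeasurableSet A) (K : ℝ≥0∞) (hK0 : K ≠ 0) (hK : K ≠ ∞) :
    Measure.pi ν A ≤ ∑ i, ν i (B i)ᶜ + K * Measure.pi μ A
      + K⁻¹ * ∏ i, ∫⁻ x, L i x ^ 2 ∂(μ i) := by
  have hprod : ∀ g : ∀ i, X i → ℝ≥0∞, (∀ i, Measurable (g i)) →
      ∫⁻ x, ∏ i, g i (x i) ∂(Measure.pi μ) = ∏ i, ∫⁻ x, g i x ∂(μ i) := by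
    intro g hg
    rw [ProbabilityTheory.lintegral_prod_eq_prod_lintegral_of_indepFun Finset.univ
      (fun i (x : ∀ i, X i) => g i (x i))
      (ProbabilityTheory.iIndepFun_pi fun i => (hg i).aemeasurable)
      (fun i => (hg i).comp (measurable_pi_apply i))]
    exact Finset.prod_congr rfl fun i _ =>
      (measurePreserving_eval μ i).lintegral_comp (hg i)
  have hLm : Measurable fun x : ∀ i, X i => ∏ i, L i (x i) :=
    Finset.measurable_fun_prod _ fun i _ => (hL i).comp (measurable_pi_apply i)
  have hdens : (Measure.pi ν).restrict (univ.pi B)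
      = (Measure.pi μ).withDensity fun x => ∏ i, L i (x i) := by
    rw [Measure.restrict_pi_pi]
    refine Measure.pi_eq fun s hs => ?_
    rw [withDensity_apply _ (MeasurableSet.univ_pi hs),
      ← lintegral_indicator (MeasurableSet.univ_pi hs)]
    have : (univ.pi s).indicator (fun x : ∀ i, X i => ∏ i, L i (x i))
        = fun x => ∏ i, (s i).indicator (L i) (x i) := by
      funext x
      by_cases hx : x ∈ univ.pi s
      · rw [indicator_of_mem hx]
        exact Finset.prod_congr rfl fun i _ =>
          (indicator_of_mem (hx i (mem_univ i)) _).symm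
      · rw [indicator_of_notMem hx]
        simp only [Set.mem_pi, mem_univ, true_imp_iff, not_forall] at hx
        obtain ⟨i, hi⟩ := hx
        exact (Finset.prod_eq_zero (Finset.mem_univ i) (indicator_of_notMem hi _)).symm
    rw [this, hprod _ fun i => (hL i).indicator (hs i)]
    refine Finset.prod_congr rfl fun i _ => ?_
    rw [hLν, withDensity_apply _ (hs i), lintegral_indicator (hs i)]
  have hsplit : Measure.pi ν A ≤ Measure.pi ν (A ∩ univ.pi B) + ∑ i, ν i (B i)ᶜ := by
    have hsub : A ⊆ (A ∩ univ.pi B) ∪ ⋃ i, Function.eval i ⁻¹' (B i)ᶜ := by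
      intro x hx
      by_cases h : x ∈ univ.pi B
      · exact Or.inl ⟨hx, h⟩
      · simp only [Set.mem_pi, mem_univ, true_imp_iff, not_forall] at h
        obtain ⟨i, hi⟩ := h
        exact Or.inr (mem_iUnion.2 ⟨i, hi⟩)
    refine (measure_mono hsub).trans ((measure_union_le _ _).trans ?_)
    gcongr
    refine (measure_iUnion_fintype_le _ _).trans (Finset.sum_le_sum fun i _ => ?_)
    rw [(measurePreserving_eval ν i).measure_preimage (hB i).compl.nullMeasurableSet]
  have hmain : Measure.pi ν (A ∩ univ.pi B)
      ≤ K * Measure.pi μ A + K⁻¹ * ∏ i, ∫⁻ x, L i x ^ 2 ∂(μ i) := by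
    rw [← Measure.restrict_apply hA, hdens, withDensity_apply _ hA,
      ← hprod _ fun i => (hL i).pow_const 2]
    -- Chebyshev's device: a likelihood ratio above the level `K` is at most its square divided by
    -- `K`.
    have hpt : ∀ l : ℝ≥0∞, l ≤ K + K⁻¹ * l ^ 2 := by
      intro l
      rcases le_total l K with h | h
      · exact h.trans le_self_add
      · refine le_add_left ?_
        calc l = K⁻¹ * K * l := by rw [ENNReal.inv_mul_cancel hK0 hK, one_mul]
          _ ≤ K⁻¹ * l * l := by gcongr
          _ = K⁻¹ * l ^ 2 := by ring
    calc ∫⁻ x in A, ∏ i, L i (x i) ∂(Measure.pi μ)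
        ≤ ∫⁻ x in A, (K + K⁻¹ * (∏ i, L i (x i)) ^ 2) ∂(Measure.pi μ) :=
          lintegral_mono fun x => hpt _
      _ = K * Measure.pi μ A + K⁻¹ * ∫⁻ x in A, (∏ i, L i (x i)) ^ 2 ∂(Measure.pi μ) := by
          rw [lintegral_add_left measurable_const, setLIntegral_const,
            lintegral_const_mul _ (hLm.pow_const 2)]
      _ ≤ _ := by
          gcongr ?_ + _ * ?_
          · exact le_rfl
          refine (setLIntegral_le_lintegral _ _).trans_eq ?_
          exact lintegral_congr fun x => (Finset.prod_pow _ _ _).symm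
  calc _ ≤ _ := hsplit
    _ ≤ (K * Measure.pi μ A + K⁻¹ * ∏ i, ∫⁻ x, L i x ^ 2 ∂(μ i)) + ∑ i, ν i (B i)ᶜ := by gcongr
    _ = _ := by ring

/-! ### Information and increments of the square root of the density -/

/-- The integrand of the information. -/
noncomputable def informationDensity (f : ℝ → ℝ) (u : ℝ) : ℝ≥0∞ :=
  ENNReal.ofReal ((deriv f u / f u) ^ 2 * f u)

theorem measurable_informationDensity {f : ℝ → ℝ} (hf : Differentiable ℝ f) :
    Measurable (informationDensity f) :=
  ((((measurable_deriv f).div hf.continuous.measurable).pow_const 2).mul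
    hf.continuous.measurable).ennreal_ofReal

/-- This is the squared slope of `√f`, up to a factor 4. At zeros of `f` both sides vanish by the
convention for division by zero. -/
theorem informationDensity_eq {f : ℝ → ℝ} (hf : ∀ u, 0 ≤ f u) (u : ℝ) :
    informationDensity f u = ENNReal.ofReal (|deriv f u| / √(f u)) ^ 2 := by
  rw [informationDensity, ← ENNReal.ofReal_pow (by positivity), div_pow |deriv f u|,
    sq_abs, Real.sq_sqrt (hf u)]
  congr 1
  rcases eq_or_ne (f u) 0 with h | h
  · simp [h]
  · field_simp

theorem IsErrorDensity.continuous_deriv {f : ℝ → ℝ} (hf : IsErrorDensity f) :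
    Continuous (deriv f) := by
  refine continuous_iff_continuousAt.2 fun u => ?_
  refine (hf.deriv_absolutelyContinuous (u - 1) (u + 1)).continuousOn.continuousAt ?_
  rw [uIcc_of_le (by linarith)]
  exact Icc_mem_nhds (by linarith) (by linarith)

theorem deriv_eq_zero_of_nonneg {f : ℝ → ℝ} (hf : ∀ u, 0 ≤ f u) {u : ℝ} (hu : f u = 0) :
    deriv f u = 0 :=
  IsLocalMin.deriv_eq_zero (Eventually.of_forall fun v => by rw [hu]; exact hf v)

/-- Increments of the square root of a nonnegative `C¹` function. -/
theorem abs_sqrt_sub_sqrt_le {f : ℝ → ℝ} (hf : ∀ u, 0 ≤ f u) (hd : Differentiable ℝ f)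
    (hc : Continuous (deriv f)) (u v : ℝ) :
    ENNReal.ofReal |√(f v) - √(f u)|
      ≤ ∫⁻ w in uIoc u v, ENNReal.ofReal (|deriv f w| / √(f w)) := by
  -- `√f` may fail to be differentiable at zeros of `f`, so `f` is replaced by `f + ε`. The bound
  -- does not depend on `ε`, which then tends to 0.
  have key : ∀ ε : ℝ, 0 < ε → ENNReal.ofReal |√(f v + ε) - √(f u + ε)|
      ≤ ∫⁻ w in uIoc u v, ENNReal.ofReal (|deriv f w| / √(f w)) := by
    intro ε hε
    have hpos : ∀ w, 0 < f w + ε := fun w => add_pos_of_nonneg_of_pos (hf w) hε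
    have hder : ∀ w, HasDerivAt (fun w => √(f w + ε)) (deriv f w / (2 * √(f w + ε))) w :=
      fun w => ((hd w).hasDerivAt.add_const ε).sqrt (hpos w).ne'
    have hcont : Continuous fun w => deriv f w / (2 * √(f w + ε)) :=
      hc.div (by have := hd.continuous; fun_prop)
        fun w => by have := Real.sqrt_pos.2 (hpos w); positivity
    rw [← intervalIntegral.integral_eq_sub_of_hasDerivAt (fun w _ => hder w)
      (hcont.intervalIntegrable u v), ← Real.norm_eq_abs,
      intervalIntegral.norm_intervalIntegral_eq, ofReal_norm]
    refine (enorm_integral_le_lintegral_enorm _).trans (lintegral_mono fun w => ?_)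
    rw [← ofReal_norm, Real.norm_eq_abs]
    refine ENNReal.ofReal_le_ofReal ?_
    have hs := Real.sqrt_pos.2 (hpos w)
    rw [abs_div, abs_of_pos (by positivity : 0 < 2 * √(f w + ε))]
    rcases (hf w).eq_or_lt with h | h
    · simp [deriv_eq_zero_of_nonneg hf h.symm]
    · have h1 : √(f w) ≤ √(f w + ε) := Real.sqrt_le_sqrt (by linarith)
      exact div_le_div_of_nonneg_left (abs_nonneg _) (Real.sqrt_pos.2 h) (by linarith)
  have hlim : Tendsto (fun ε : ℝ => ENNReal.ofReal |√(f v + ε) - √(f u + ε)|) (𝓝[>] 0)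
      (𝓝 (ENNReal.ofReal |√(f v) - √(f u)|)) := by
    have : Continuous fun ε : ℝ => ENNReal.ofReal |√(f v + ε) - √(f u + ε)| :=
      ENNReal.continuous_ofReal.comp (by fun_prop)
    simpa using (this.tendsto 0).mono_left nhdsWithin_le_nhds
  exact le_of_tendsto hlim (eventually_mem_nhdsWithin.mono fun ε hε => key ε hε)

theorem sq_setLIntegral_le {α : Type*} [MeasurableSpace α] (μ : Measure α) (s : Set α)
    {g : α → ℝ≥0∞} (hg : Measurable g) :
    (∫⁻ x in s, g x ∂μ) ^ 2 ≤ μ s * ∫⁻ x in s, g x ^ 2 ∂μ := by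
  have h := ENNReal.lintegral_mul_le_Lp_mul_Lq (μ.restrict s) Real.HolderConjugate.two_two
    (f := g) (g := fun _ => 1) hg.aemeasurable aemeasurable_const
  simp only [Pi.mul_apply, mul_one, ENNReal.one_rpow, lintegral_const, one_mul,
    Measure.restrict_apply MeasurableSet.univ, univ_inter] at h
  calc _ ≤ _ := pow_le_pow_left' h 2
    _ = _ := by
      rw [mul_pow, ← ENNReal.rpow_natCast, ← ENNReal.rpow_natCast, ← ENNReal.rpow_mul,
        ← ENNReal.rpow_mul]
      simp [mul_comm]

/-- The squared increment `(√f(u - a) - √f(u))²`. -/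
noncomputable def sqrtIncrement (f : ℝ → ℝ) (a u : ℝ) : ℝ≥0∞ :=
  ENNReal.ofReal ((√(f (u - a)) - √(f u)) ^ 2)

/-- Cauchy–Schwarz over the shifts between 0 and `a` gives one factor `|a|`; Tonelli and the uniform
bound `D` give the other. The set `S` is kept general to serve both the whole line and the set where
the ratio is large. -/
theorem setLIntegral_sqrtIncrement_le {f : ℝ → ℝ} (hf : ∀ u, 0 ≤ f u) (hd : Differentiable ℝ f)
    (hc : Continuous (deriv f)) (a : ℝ) (S : Set ℝ) (D : ℝ≥0∞)
    (hD : ∀ s ∈ uIcc 0 a, ∫⁻ u in S, informationDensity f (u - s) ≤ D) :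
    ∫⁻ u in S, sqrtIncrement f a u ≤ ENNReal.ofReal (a ^ 2) * D := by
  have hJ := measurable_informationDensity hd
  have hψ : Measurable fun w => ENNReal.ofReal (|deriv f w| / √(f w)) := by
    have := hd.continuous.measurable
    have := measurable_deriv f
    fun_prop
  have hvol : volume (uIcc 0 a) = ENNReal.ofReal |a| := by
    rw [Real.volume_interval, sub_zero]
  have hpt : ∀ u, sqrtIncrement f a u
      ≤ ENNReal.ofReal |a| * ∫⁻ s in uIcc 0 a, informationDensity f (u - s) := by
    intro u
    have h1 : ENNReal.ofReal |√(f (u - a)) - √(f u)|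
        ≤ ∫⁻ s in uIcc 0 a, ENNReal.ofReal (|deriv f (u - s)| / √(f (u - s))) := by
      refine (abs_sqrt_sub_sqrt_le hf hd hc u (u - a)).trans ?_
      rw [← lintegral_indicator measurableSet_uIoc, ← lintegral_indicator measurableSet_uIcc,
        ← lintegral_sub_left_eq_self _ u]
      refine lintegral_mono fun s => ?_
      by_cases hs : u - s ∈ uIoc u (u - a)
      · have hs' : s ∈ uIcc 0 a := by
          have := uIoc_subset_uIcc hs
          rw [mem_uIcc] at this ⊢
          rcases this with h | h
          · right; constructor <;> linarith [h.1, h.2]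
          · left; constructor <;> linarith [h.1, h.2]
        rw [indicator_of_mem hs, indicator_of_mem hs']
      · rw [indicator_of_notMem hs]
        exact zero_le
    rw [sqrtIncrement, ← sq_abs, ENNReal.ofReal_pow (abs_nonneg _)]
    refine (pow_le_pow_left' h1 2).trans ((sq_setLIntegral_le volume _
      (hψ.comp (measurable_const.sub measurable_id))).trans_eq ?_)
    rw [hvol]
    congr 1
    exact lintegral_congr fun s => (informationDensity_eq hf _).symm
  calc ∫⁻ u in S, sqrtIncrement f a u
      ≤ ∫⁻ u in S, ENNReal.ofReal |a| * ∫⁻ s in uIcc 0 a, informationDensity f (u - s) :=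
        lintegral_mono fun u => hpt u
    _ = ENNReal.ofReal |a| * ∫⁻ u in S, ∫⁻ s in uIcc 0 a, informationDensity f (u - s) :=
        lintegral_const_mul' _ _ ENNReal.ofReal_ne_top
    _ = ENNReal.ofReal |a| * ∫⁻ s in uIcc 0 a, ∫⁻ u in S, informationDensity f (u - s) := by
        rw [lintegral_lintegral_swap]
        exact (hJ.comp (measurable_fst.sub measurable_snd)).aemeasurable
    _ ≤ ENNReal.ofReal |a| * ∫⁻ s in uIcc 0 a, D := by
        refine mul_le_mul_right ?_ _
        exact setLIntegral_mono measurable_const hD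
    _ = ENNReal.ofReal (a ^ 2) * D := by
        rw [setLIntegral_const, hvol, ← sq_abs, ENNReal.ofReal_pow (abs_nonneg _)]
        ring

theorem lintegral_sqrtIncrement_le {f : ℝ → ℝ} (hf : IsErrorDensity f) (a : ℝ) :
    ∫⁻ u, sqrtIncrement f a u ≤ ENNReal.ofReal (a ^ 2) * fisherInformation f := by
  rw [← setLIntegral_univ]
  refine setLIntegral_sqrtIncrement_le hf.nonneg hf.differentiable hf.continuous_deriv _ _ _
    fun s _ => ?_
  rw [setLIntegral_univ, lintegral_sub_right_eq_self (informationDensity f) s]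
  exact le_rfl

/-- The part of the squared increment where the translated density is much larger than the original
one is negligible. -/
theorem exists_setLIntegral_sqrtIncrement_le {f : ℝ → ℝ} (hf : IsErrorDensity f) {η : ℝ≥0∞}
    (hη : 0 < η) : ∃ δ > 0, ∀ a : ℝ, |a| < δ →
      ∫⁻ u in {u | 4 * f u < f (u - a)}, sqrtIncrement f a u ≤ ENNReal.ofReal (a ^ 2) * η := by
  -- Points near which `f` varies by more than a factor 4. By continuity, a point with `f v > 0`
  -- leaves `T δ` for small `δ`, and at zeros of `f` the information density is 0; dominated
  -- convergence then applies.
  let T : ℝ → Set ℝ := fun δ =>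
    {v | ∃ w w', |w - v| < δ ∧ |w' - v| < δ ∧ 4 * f w < f w'}
  have hTopen : ∀ δ, IsOpen (T δ) := by
    intro δ
    have : T δ = ⋃ w, ⋃ w', ⋃ (_ : 4 * f w < f w'),
        ({v | |w - v| < δ} ∩ {v | |w' - v| < δ}) := by
      ext v
      simp only [T, mem_ofPred_eq, mem_iUnion, mem_inter_iff, exists_prop]
      exact exists_congr fun w => exists_congr fun w' => by tauto
    rw [this]
    refine isOpen_iUnion fun w => isOpen_iUnion fun w' => isOpen_iUnion fun _ => ?_
    exact (isOpen_lt (by fun_prop) continuous_const).inter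
      (isOpen_lt (by fun_prop) continuous_const)
  have hlim : Tendsto (fun δ => ∫⁻ v, (T δ).indicator (informationDensity f) v) (𝓝[>] 0)
      (𝓝 (∫⁻ _ : ℝ, 0)) := by
    have hJ := measurable_informationDensity hf.differentiable
    refine tendsto_lintegral_filter_of_dominated_convergence (informationDensity f)
      (Eventually.of_forall fun δ => hJ.indicator (hTopen δ).measurableSet)
      (Eventually.of_forall fun δ => Eventually.of_forall fun v => indicator_le_self _ _ _)
      hf.information_lt_top.ne (Eventually.of_forall fun v => ?_)
    refine tendsto_const_nhds.congr' ?_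
    rcases (hf.nonneg v).eq_or_lt with h | h
    · refine Eventually.of_forall fun δ => ?_
      have : informationDensity f v = 0 := by simp [informationDensity, ← h]
      exact (indicator_apply_eq_zero.2 fun _ => this).symm
    · have hev : ∀ᶠ w in 𝓝 v, f v / 2 < f w ∧ f w < 2 * f v :=
        (hf.differentiable.continuous.continuousAt.eventually_const_lt (by linarith)).and
          (hf.differentiable.continuous.continuousAt.eventually_lt_const (by linarith))
      obtain ⟨δ₀, hδ₀, hball⟩ := Metric.eventually_nhds_iff.1 hev
      filter_upwards [mem_nhdsWithin_of_mem_nhds (Iio_mem_nhds hδ₀)] with δ hδ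
      refine (indicator_of_notMem ?_ _).symm
      rintro ⟨w, w', hw, hw', hlt⟩
      have h1 := hball (y := w) (by rw [Real.dist_eq]; exact hw.trans hδ)
      have h2 := hball (y := w') (by rw [Real.dist_eq]; exact hw'.trans hδ)
      linarith [h1.1, h2.2]
  rw [lintegral_zero] at hlim
  obtain ⟨δ, hδη, hδ⟩ := ((hlim.eventually (ge_mem_nhds hη)).and eventually_mem_nhdsWithin).exists
  rw [mem_Ioi] at hδ
  -- Seen from `u - s`, the points `u` and `u - a` lie at distances `|s|` and `|a - s|`, both at
  -- most `|a| + |s| ≤ 2 |a| < δ`.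
  refine ⟨δ / 2, half_pos hδ, fun a ha => ?_⟩
  refine setLIntegral_sqrtIncrement_le hf.nonneg hf.differentiable hf.continuous_deriv _ _ _
    fun s hs => le_trans ?_ hδη
  have hS : MeasurableSet {u | 4 * f u < f (u - a)} := by
    have := hf.differentiable.continuous
    exact (isOpen_lt (by fun_prop) (by fun_prop)).measurableSet
  rw [← lintegral_indicator hS,
    ← lintegral_sub_right_eq_self ((T δ).indicator (informationDensity f)) s]
  refine lintegral_mono fun u => ?_
  by_cases hu : u ∈ {u | 4 * f u < f (u - a)}
  · rw [indicator_of_mem hu, indicator_of_mem]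
    have hsa : |s| ≤ |a| := by
      rw [mem_uIcc] at hs
      rcases hs with h | h
      · exact abs_le_abs h.2 (by linarith [h.1, h.2])
      · rw [abs_of_nonpos h.2, abs_of_nonpos (h.1.trans h.2)]; linarith [h.1]
    refine ⟨u, u - a, ?_, ?_, hu⟩
    · rw [sub_sub_cancel]; linarith
    · rw [sub_sub_sub_cancel_left]
      exact (abs_sub _ _).trans_lt (by linarith)
  · rw [indicator_of_notMem hu]
    exact zero_le

/-! ### Truncated likelihood ratios of translates -/

theorem IsErrorDensity.isProbabilityMeasure {f : ℝ → ℝ} (hf : IsErrorDensity f) :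
    IsProbabilityMeasure (errorLaw f) :=
  ⟨by rw [errorLaw, withDensity_apply _ MeasurableSet.univ, setLIntegral_univ,
    hf.lintegral_eq_one]⟩

theorem IsErrorDensity.measurable {f : ℝ → ℝ} (hf : IsErrorDensity f) : Measurable f :=
  hf.differentiable.continuous.measurable

theorem map_add_errorLaw (f : ℝ → ℝ) (a : ℝ) :
    (errorLaw f).map (a + ·) = errorLaw fun u => f (u - a) := by
  ext s hs
  have hm : Measurable fun u : ℝ => a + u := measurable_const_add a
  rw [Measure.map_apply hm hs, errorLaw, errorLaw, withDensity_apply _ (hm hs),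
    withDensity_apply _ hs, ← lintegral_indicator hs, ← lintegral_indicator (hm hs),
    ← lintegral_add_left_eq_self (s.indicator fun u => ENNReal.ofReal (f (u - a))) a]
  refine lintegral_congr fun u => ?_
  by_cases hu : a + u ∈ s
  · rw [indicator_of_mem hu, indicator_of_mem (mem_preimage.2 hu), add_sub_cancel_left]
  · rw [indicator_of_notMem hu, indicator_of_notMem (mem_preimage.not.2 hu)]

/-- The likelihood ratio of a translate, truncated where it exceeds `4`. -/
noncomputable def truncatedRatio (f : ℝ → ℝ) (a u : ℝ) : ℝ≥0∞ :=
  {u | f (u - a) ≤ 4 * f u}.indicator (fun u => ENNReal.ofReal (f (u - a) / f u)) u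

theorem measurableSet_ratio_le {f : ℝ → ℝ} (hf : Measurable f) (a : ℝ) :
    MeasurableSet {u | f (u - a) ≤ 4 * f u} :=
  measurableSet_le (hf.comp (measurable_sub_const a)) (hf.const_mul 4)

theorem measurable_truncatedRatio {f : ℝ → ℝ} (hf : Measurable f) (a : ℝ) :
    Measurable (truncatedRatio f a) :=
  ((hf.comp (measurable_sub_const a)).div hf).ennreal_ofReal.indicator
    (measurableSet_ratio_le hf a)

theorem measurable_sqrtIncrement {f : ℝ → ℝ} (hf : Measurable f) (a : ℝ) :
    Measurable (sqrtIncrement f a) :=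
  (((hf.comp (measurable_sub_const a)).sqrt.sub hf.sqrt).pow_const 2).ennreal_ofReal

theorem restrict_errorLaw_eq {f : ℝ → ℝ} (hf : Measurable f) (hf0 : ∀ u, 0 ≤ f u) (a : ℝ) :
    (errorLaw fun u => f (u - a)).restrict {u | f (u - a) ≤ 4 * f u}
      = (errorLaw f).withDensity (truncatedRatio f a) := by
  rw [errorLaw, errorLaw, restrict_withDensity (measurableSet_ratio_le hf a),
    ← withDensity_indicator (measurableSet_ratio_le hf a),
    ← withDensity_mul _ hf.ennreal_ofReal (measurable_truncatedRatio hf a)]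
  congr 1
  funext u
  rw [Pi.mul_apply, truncatedRatio]
  by_cases hu : u ∈ {u | f (u - a) ≤ 4 * f u}
  · rw [indicator_of_mem hu, indicator_of_mem hu, ← ENNReal.ofReal_mul (hf0 u)]
    congr 1
    rcases eq_or_ne (f u) 0 with h | h
    · have : f (u - a) ≤ 4 * f u := hu
      rw [h] at this ⊢
      linarith [hf0 (u - a)]
    · field_simp
  · rw [indicator_of_notMem hu, indicator_of_notMem hu, mul_zero]

/-- With `p = x ^ 2` and `q = y ^ 2`, the left side minus `2 * q` is `(y - x) ^ 2 * ((y + x) / x) ^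
2`, and the truncation `y ≤ 2 * x` bounds the last factor by `3 ^ 2`. -/
theorem sq_div_add_le {p q : ℝ} (hp : 0 ≤ p) (hq : 0 ≤ q) (h : q ≤ 4 * p) :
    p * (q / p) ^ 2 + p ≤ 9 * (√q - √p) ^ 2 + 2 * q := by
  rcases hp.eq_or_lt with h0 | h0
  · subst h0
    have : q = 0 := by linarith
    simp [this]
  obtain ⟨x, hx, rfl⟩ : ∃ x, 0 < x ∧ p = x ^ 2 :=
    ⟨√p, Real.sqrt_pos.2 h0, (Real.sq_sqrt hp).symm⟩
  obtain ⟨y, hy, rfl⟩ : ∃ y, 0 ≤ y ∧ q = y ^ 2 := ⟨√q, Real.sqrt_nonneg _, (Real.sq_sqrt hq).symm⟩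
  rw [Real.sqrt_sq hy, Real.sqrt_sq hx.le]
  have hyx : y ≤ 2 * x := by nlinarith
  have h1 : x ^ 2 * (y ^ 2 / x ^ 2) ^ 2 + x ^ 2 - 2 * y ^ 2
      = (y - x) ^ 2 * ((y + x) / x) ^ 2 := by
    field_simp
    ring
  have h2 : ((y + x) / x) ^ 2 ≤ 3 ^ 2 := by
    gcongr
    rw [div_le_iff₀ hx]
    linarith
  nlinarith [mul_le_mul_of_nonneg_left h2 (sq_nonneg (y - x))]

theorem lintegral_translate {f : ℝ → ℝ} (hf : IsErrorDensity f) (a : ℝ) :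
    ∫⁻ u, ENNReal.ofReal (f (u - a)) = 1 := by
  rw [lintegral_sub_right_eq_self (fun u => ENNReal.ofReal (f u)) a, hf.lintegral_eq_one]

theorem lintegral_truncatedRatio_sq_le {f : ℝ → ℝ} (hf : IsErrorDensity f) (a : ℝ) :
    ∫⁻ u, truncatedRatio f a u ^ 2 ∂(errorLaw f)
      ≤ ENNReal.ofReal (1 + 9 * (fisherInformation f).toReal * a ^ 2) := by
  have hm := hf.measurable
  have hpt : ∀ u, ENNReal.ofReal (f u) * truncatedRatio f a u ^ 2 + ENNReal.ofReal (f u)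
      ≤ 9 * sqrtIncrement f a u + 2 * ENNReal.ofReal (f (u - a)) := by
    intro u
    have hp := hf.nonneg u
    have hq := hf.nonneg (u - a)
    have hR : 9 * sqrtIncrement f a u + 2 * ENNReal.ofReal (f (u - a))
        = ENNReal.ofReal (9 * (√(f (u - a)) - √(f u)) ^ 2 + 2 * f (u - a)) := by
      rw [ENNReal.ofReal_add (by positivity) (by positivity), ENNReal.ofReal_mul (by norm_num),
        ENNReal.ofReal_mul (by norm_num), sqrtIncrement]
      simp
    rw [hR, truncatedRatio]
    by_cases hu : u ∈ {u | f (u - a) ≤ 4 * f u}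
    · rw [indicator_of_mem hu, ← ENNReal.ofReal_pow (by positivity), ← ENNReal.ofReal_mul hp,
        ← ENNReal.ofReal_add (by positivity) hp]
      exact ENNReal.ofReal_le_ofReal (sq_div_add_le hp hq hu)
    · rw [indicator_of_notMem hu]
      simp only [ne_eq, OfNat.ofNat_ne_zero, not_false_eq_true, zero_pow, mul_zero, zero_add]
      refine ENNReal.ofReal_le_ofReal ?_
      have : 4 * f u < f (u - a) := not_le.1 hu
      nlinarith [sq_nonneg (√(f (u - a)) - √(f u))]
  -- The pointwise bound is integrated with the cross term moved to the right, to avoid subtraction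
  -- in `ℝ≥0∞`; cancelling 1 leaves the constant `2 - 1 = 1`, whose powers stay bounded.
  have hint : ∫⁻ u, truncatedRatio f a u ^ 2 ∂(errorLaw f) + 1
      ≤ 9 * (∫⁻ u, sqrtIncrement f a u) + 2 := by
    have h := lintegral_mono (μ := volume) hpt
    rw [lintegral_add_right _ hm.ennreal_ofReal, hf.lintegral_eq_one,
      lintegral_add_left ((measurable_sqrtIncrement hm a).const_mul 9),
      lintegral_const_mul' _ _ (by norm_num), lintegral_const_mul' _ _ (by norm_num),
      lintegral_translate hf a, mul_one] at h
    rw [errorLaw, lintegral_withDensity_eq_lintegral_mul _ hm.ennreal_ofReal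
      ((measurable_truncatedRatio hm a).pow_const 2)]
    exact h
  have hI := ENNReal.ofReal_toReal hf.information_lt_top.ne
  have h2 : ∫⁻ u, truncatedRatio f a u ^ 2 ∂(errorLaw f) + 1
      ≤ (1 + 9 * (ENNReal.ofReal (a ^ 2) * fisherInformation f)) + 1 := by
    refine hint.trans ?_
    calc 9 * (∫⁻ u, sqrtIncrement f a u) + 2
        ≤ 9 * (ENNReal.ofReal (a ^ 2) * fisherInformation f) + 2 := by
          gcongr
          exact lintegral_sqrtIncrement_le hf a
      _ = _ := by ring
  refine ((ENNReal.add_le_add_iff_right ENNReal.one_ne_top).1 h2).trans_eq ?_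
  rw [ENNReal.ofReal_add zero_le_one (by positivity), ENNReal.ofReal_mul (by positivity),
    ENNReal.ofReal_mul (by norm_num), hI]
  simp only [ENNReal.ofReal_one, ENNReal.ofReal_ofNat]
  ring

theorem translate_compl_ratio_le {f : ℝ → ℝ} (hf : IsErrorDensity f) (a : ℝ) :
    errorLaw (fun u => f (u - a)) {u | f (u - a) ≤ 4 * f u}ᶜ
      ≤ 4 * ∫⁻ u in {u | 4 * f u < f (u - a)}, sqrtIncrement f a u := by
  have hm := hf.measurable
  have hset : {u | f (u - a) ≤ 4 * f u}ᶜ = {u | 4 * f u < f (u - a)} := by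
    ext u
    simp
  rw [hset, errorLaw, withDensity_apply _ (hset ▸ (measurableSet_ratio_le hm a).compl),
    ← lintegral_const_mul' _ _ (by norm_num)]
  refine setLIntegral_mono ((measurable_sqrtIncrement hm a).const_mul 4) fun u hu => ?_
  have hp := hf.nonneg u
  have hq := hf.nonneg (u - a)
  have hu' : 4 * f u < f (u - a) := hu
  have : (4 : ℝ≥0∞) = ENNReal.ofReal 4 := by simp
  rw [sqrtIncrement, this, ← ENNReal.ofReal_mul (by norm_num)]
  refine ENNReal.ofReal_le_ofReal ?_
  -- Hence `√(f (u - a))` is at most twice the increment; squaring gives the factor 4.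
  have h1 : 2 * √(f u) ≤ √(f (u - a)) := by
    refine Real.le_sqrt_of_sq_le ?_
    rw [mul_pow, Real.sq_sqrt hp]
    linarith
  nlinarith [Real.sq_sqrt hq, Real.sqrt_nonneg (f u), Real.sqrt_nonneg (f (u - a))]

/-! ### Contiguity under small translations -/

/-- Contiguity of the joint laws of independent errors under translations that are uniformly small
and bounded in the Euclidean norm. -/
theorem tendsto_pi_translate_zero {f : ℝ → ℝ} (hf : IsErrorDensity f) (a : ∀ n, Fin n → ℝ)
    {M : ℝ} (hM : ∀ᶠ n in atTop, ∑ t, a n t ^ 2 ≤ M)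
    (hmax : ∀ δ > 0, ∀ᶠ n in atTop, ∀ t, |a n t| < δ)
    (A : ∀ n, Set (Fin n → ℝ)) (hA : ∀ n, MeasurableSet (A n))
    (h0 : Tendsto (fun n => Measure.pi (fun _ : Fin n => errorLaw f) (A n)) atTop (𝓝 0)) :
    Tendsto (fun n => Measure.pi (fun t : Fin n => (errorLaw f).map (a n t + ·)) (A n))
      atTop (𝓝 0) := by
  have hm := hf.measurable
  have := hf.isProbabilityMeasure
  set I := (fisherInformation f).toReal with hIdef
  have hI : 0 ≤ I := ENNReal.toReal_nonneg
  set C : ℝ≥0∞ := 4 * ENNReal.ofReal M + ENNReal.ofReal (Real.exp (9 * I * M)) with hC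
  have hCtop : C ≠ ∞ := by simp [hC, ENNReal.mul_eq_top]
  rw [ENNReal.tendsto_nhds_zero]
  intro ε hε
  have hNlim : Tendsto (fun N : ℕ => (N : ℝ≥0∞)⁻¹ * C) atTop (𝓝 0) := by
    simpa using ENNReal.Tendsto.mul_const ENNReal.tendsto_inv_nat_nhds_zero (Or.inr hCtop)
  have hε2 : 0 < ε / 2 := ENNReal.half_pos hε.ne'
  -- `N` plays two roles: it is the level `K` of the change of measure, and `N⁻¹` is the `η`
  -- controlling the discarded mass.
  obtain ⟨N, hN, hN1⟩ :=
    ((hNlim.eventually (ge_mem_nhds hε2)).and (eventually_ge_atTop 1)).exists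
  have hN0 : (N : ℝ≥0∞) ≠ 0 := by
    simpa using Nat.one_le_iff_ne_zero.1 hN1
  have hNt : (N : ℝ≥0∞) ≠ ∞ := ENNReal.natCast_ne_top N
  obtain ⟨δ, hδ, hδa⟩ := exists_setLIntegral_sqrtIncrement_le hf (ENNReal.inv_pos.2 hNt)
  have hPlim : Tendsto (fun n => (N : ℝ≥0∞) * Measure.pi (fun _ : Fin n => errorLaw f) (A n))
      atTop (𝓝 0) := by
    simpa using ENNReal.Tendsto.const_mul h0 (Or.inr hNt)
  filter_upwards [hM, hmax δ hδ, hPlim.eventually (ge_mem_nhds hε2)] with n hMn hδn hPn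
  have hprob : ∀ t : Fin n, IsProbabilityMeasure (errorLaw fun u => f (u - a n t)) := fun t => by
    rw [← map_add_errorLaw f]
    exact Measure.isProbabilityMeasure_map (measurable_const_add _).aemeasurable
  simp_rw [map_add_errorLaw f]
  have hbound := pi_le_of_truncated_density (fun _ : Fin n => errorLaw f)
    (fun t => errorLaw fun u => f (u - a n t)) (fun t => {u | f (u - a n t) ≤ 4 * f u})
    (fun t => measurableSet_ratio_le hm _) (fun t => truncatedRatio f (a n t))
    (fun t => measurable_truncatedRatio hm _) (fun t => restrict_errorLaw_eq hm hf.nonneg _)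
    (A n) (hA n) N hN0 hNt
  have hsum : ∑ t, errorLaw (fun u => f (u - a n t)) {u | f (u - a n t) ≤ 4 * f u}ᶜ
      ≤ (N : ℝ≥0∞)⁻¹ * (4 * ENNReal.ofReal M) := by
    calc _ ≤ ∑ t, 4 * (ENNReal.ofReal (a n t ^ 2) * (N : ℝ≥0∞)⁻¹) :=
          Finset.sum_le_sum fun t _ => (translate_compl_ratio_le hf _).trans
            (mul_le_mul_right (hδa _ (hδn t)) 4)
      _ = (N : ℝ≥0∞)⁻¹ * (4 * ENNReal.ofReal (∑ t, a n t ^ 2)) := by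
          rw [← Finset.mul_sum, ← Finset.sum_mul,
            ENNReal.ofReal_sum_of_nonneg fun t _ => sq_nonneg _]
          ring
      _ ≤ _ := by gcongr
  have hprod : ∏ t, ∫⁻ u, truncatedRatio f (a n t) u ^ 2 ∂(errorLaw f)
      ≤ ENNReal.ofReal (Real.exp (9 * I * M)) := by
    calc _ ≤ ∏ t, ENNReal.ofReal (1 + 9 * I * a n t ^ 2) :=
          Finset.prod_le_prod' fun t _ => lintegral_truncatedRatio_sq_le hf _
      _ = ENNReal.ofReal (∏ t, (1 + 9 * I * a n t ^ 2)) :=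
          (ENNReal.ofReal_prod_of_nonneg fun t _ => by positivity).symm
      _ ≤ _ := by
          refine ENNReal.ofReal_le_ofReal ?_
          refine (Real.prod_one_add_le_exp_sum _ fun t => by positivity).trans ?_
          rw [← Finset.mul_sum]
          gcongr
  calc _ ≤ _ := hbound
    _ ≤ (N : ℝ≥0∞)⁻¹ * (4 * ENNReal.ofReal M)
        + N * Measure.pi (fun _ : Fin n => errorLaw f) (A n)
        + (N : ℝ≥0∞)⁻¹ * ENNReal.ofReal (Real.exp (9 * I * M)) := by gcongr
    _ = (N : ℝ≥0∞)⁻¹ * C + N * Measure.pi (fun _ : Fin n => errorLaw f) (A n) := by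
        rw [hC]; ring
    _ ≤ ε / 2 + ε / 2 := add_le_add hN hPn
    _ = ε := ENNReal.add_halves ε

/-- If the averages of a nonnegative sequence converge, then its largest terms are negligible. -/
theorem eventually_forall_lt_of_tendsto_average {c : ℕ → ℝ} (hc : ∀ t, 0 ≤ c t) {L : ℝ}
    (h : Tendsto (fun n : ℕ => (n : ℝ)⁻¹ * ∑ t ∈ Finset.range n, c t) atTop (𝓝 L))
    {δ : ℝ} (hδ : 0 < δ) : ∀ᶠ n : ℕ in atTop, ∀ t < n, (n : ℝ)⁻¹ * c t < δ := by
  -- With `S n` the average of the first `n` terms, `c n / (n + 1) = S (n + 1) - n / (n + 1) * S n`,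
  -- which tends to `L - L`.
  have h1 : Tendsto (fun n : ℕ => ((n + 1 : ℕ) : ℝ)⁻¹ * c n) atTop (𝓝 0) := by
    have hs := (tendsto_add_atTop_iff_nat 1).2 h
    have hr : Tendsto (fun n : ℕ => (n : ℝ) / (n + 1)) atTop (𝓝 1) :=
      tendsto_natCast_div_add_atTop 1
    have := hs.sub (hr.mul h)
    rw [one_mul, sub_self] at this
    refine this.congr' ((eventually_ge_atTop 1).mono fun n hn => ?_)
    have hn' : (n : ℝ) ≠ 0 := by positivity
    rw [Finset.sum_range_succ]
    push_cast
    field_simp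
    ring
  obtain ⟨N, hN⟩ := eventually_atTop.1 (h1.eventually (gt_mem_nhds hδ))
  have h2 : ∀ᶠ n : ℕ in atTop, ∀ t ∈ Finset.range N, (n : ℝ)⁻¹ * c t < δ := by
    rw [Finset.eventually_all]
    intro t _
    have : Tendsto (fun n : ℕ => (n : ℝ)⁻¹ * c t) atTop (𝓝 0) := by
      simpa using (tendsto_inv_atTop_nhds_zero_nat (𝕜 := ℝ)).mul_const (c t)
    exact this.eventually (gt_mem_nhds hδ)
  filter_upwards [h2] with n hn t htn
  -- The finitely many early terms are killed by `n⁻¹`; for late ones, `t + 1 ≤ n` gives `n⁻¹ * c t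
  -- ≤ (t + 1)⁻¹ * c t`.
  rcases lt_or_ge t N with ht | ht
  · exact hn t (Finset.mem_range.2 ht)
  · refine lt_of_le_of_lt ?_ (hN t ht)
    have : ((t + 1 : ℕ) : ℝ) ≤ n := by exact_mod_cast htn
    have := hc t
    gcongr

/-! ### Local alternatives in the regression model and the maximal risk -/

variable {k : ℕ}

theorem sampleLaw_eq_pi {f : ℝ → ℝ} (hf : IsErrorDensity f)
    (x : ℕ → EuclideanSpace ℝ (Fin k)) (n : ℕ) (θ : EuclideanSpace ℝ (Fin k)) :
    sampleLaw f x n θ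
      = Measure.pi fun t : Fin n => (errorLaw f).map (inner ℝ (x (t : ℕ)) θ + ·) := by
  have := hf.isProbabilityMeasure
  have : ∀ t : Fin n, IsProbabilityMeasure
      ((errorLaw f).map (inner ℝ (x (t : ℕ)) θ + ·)) := fun t =>
    Measure.isProbabilityMeasure_map (measurable_const_add _).aemeasurable
  rw [sampleLaw, ← Measure.pi_map_pi fun t => (measurable_const_add _).aemeasurable]

theorem isProbabilityMeasure_sampleLaw {f : ℝ → ℝ} (hf : IsErrorDensity f)
    (x : ℕ → EuclideanSpace ℝ (Fin k)) (n : ℕ) (θ : EuclideanSpace ℝ (Fin k)) :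
    IsProbabilityMeasure (sampleLaw f x n θ) := by
  have := hf.isProbabilityMeasure
  exact Measure.isProbabilityMeasure_map
    (measurable_pi_lambda _ fun t => (measurable_pi_apply t).const_add _).aemeasurable

theorem sampleLaw_zero {f : ℝ → ℝ} (hf : IsErrorDensity f)
    (x : ℕ → EuclideanSpace ℝ (Fin k)) (n : ℕ) :
    sampleLaw f x n 0 = Measure.pi fun _ : Fin n => errorLaw f := by
  rw [sampleLaw_eq_pi hf]
  simp

theorem average_inner_sq_eq (x : ℕ → EuclideanSpace ℝ (Fin k)) (n : ℕ)
    (s : EuclideanSpace ℝ (Fin k)) :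
    (n : ℝ)⁻¹ * ∑ t ∈ Finset.range n, inner ℝ (x t) s ^ 2
      = s.ofLp ⬝ᵥ (designMatrix x n).mulVec s.ofLp := by
  rw [designMatrix, Matrix.smul_mulVec, dotProduct_smul, smul_eq_mul, Matrix.sum_mulVec,
    dotProduct_sum]
  congr 1
  refine Finset.sum_congr rfl fun t _ => ?_
  rw [Matrix.vecMulVec_mulVec, EuclideanSpace.inner_eq_star_dotProduct]
  simp [dotProduct_comm, sq]

/-- Contiguity of the sample laws at the local alternatives `-s / √n` with respect to the law at
`0`. -/
theorem tendsto_sampleLaw_local_alternative {f : ℝ → ℝ} (hf : IsErrorDensity f)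
    (x : ℕ → EuclideanSpace ℝ (Fin k)) {Q : Matrix (Fin k) (Fin k) ℝ}
    (hx : Tendsto (fun n : ℕ => designMatrix x n) atTop (𝓝 Q)) (s : EuclideanSpace ℝ (Fin k))
    (A : ∀ n, Set (Fin n → ℝ)) (hA : ∀ n, MeasurableSet (A n))
    (h0 : Tendsto (fun n => sampleLaw f x n 0 (A n)) atTop (𝓝 0)) :
    Tendsto (fun n : ℕ => sampleLaw f x n (-(√n)⁻¹ • s) (A n)) atTop (𝓝 0) := by
  have havg : Tendsto (fun n : ℕ => (n : ℝ)⁻¹ * ∑ t ∈ Finset.range n, inner ℝ (x t) s ^ 2)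
      atTop (𝓝 (s.ofLp ⬝ᵥ Q.mulVec s.ofLp)) := by
    simp_rw [average_inner_sq_eq]
    have : Continuous fun M : Matrix (Fin k) (Fin k) ℝ => s.ofLp ⬝ᵥ M.mulVec s.ofLp := by
      fun_prop
    exact (this.tendsto Q).comp hx
  have hsq : ∀ (n : ℕ) (t : ℕ), (inner ℝ (x t) (-(√n)⁻¹ • s) : ℝ) ^ 2
      = (n : ℝ)⁻¹ * inner ℝ (x t) s ^ 2 := by
    intro n t
    rw [inner_smul_right, mul_pow, neg_sq, inv_pow, Real.sq_sqrt (Nat.cast_nonneg n)]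
  simp_rw [sampleLaw_zero hf] at h0
  simp_rw [sampleLaw_eq_pi hf]
  refine tendsto_pi_translate_zero hf
    (fun n t => inner ℝ (x (t : ℕ)) (-(√n)⁻¹ • s)) (M := s.ofLp ⬝ᵥ Q.mulVec s.ofLp + 1)
    ?_ ?_ A hA h0
  · filter_upwards [havg.eventually (ge_mem_nhds (lt_add_one _))] with n hn
    simp_rw [hsq]
    rwa [← Finset.mul_sum, Fin.sum_univ_eq_sum_range fun t => (inner ℝ (x t) s : ℝ) ^ 2]
  · intro δ hδ
    filter_upwards [eventually_forall_lt_of_tendsto_average (fun t => sq_nonneg _) havg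
      (pow_pos hδ 2)] with n hn t
    refine abs_lt_of_sq_lt_sq ?_ hδ.le
    rw [hsq]
    exact hn t t.2

theorem r_le_r_zero_iff (θ : EuclideanSpace ℝ (Fin k)) :
    r θ ≤ r (0 : EuclideanSpace ℝ (Fin k)) ↔ θ = 0 := by
  constructor
  · intro h
    ext i
    by_contra hi
    have hi' : θ i ≠ 0 := hi
    have := h i
    simp only [r, PiLp.zero_apply, if_true, if_neg hi'] at this
    linarith
  · rintro rfl
    exact le_rfl

/-- A sparse estimator vanishes with probability tending to one along local alternatives. -/
theorem tendsto_sampleLaw_estimator_eq_zero {f : ℝ → ℝ} (hf : IsErrorDensity f)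
    (x : ℕ → EuclideanSpace ℝ (Fin k)) {Q : Matrix (Fin k) (Fin k) ℝ}
    (hx : Tendsto (fun n : ℕ => designMatrix x n) atTop (𝓝 Q))
    (θhat : (n : ℕ) → (Fin n → ℝ) → EuclideanSpace ℝ (Fin k))
    (hθhat : ∀ n : ℕ, Measurable (θhat n)) (hsparse : SparsityTypeCondition f x θhat)
    (s : EuclideanSpace ℝ (Fin k)) :
    Tendsto (fun n : ℕ => sampleLaw f x n (-(√n)⁻¹ • s) {y | θhat n y = 0}) atTop (𝓝 1) := by
  have hE : ∀ n, MeasurableSet {y | θhat n y = 0} := fun n =>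
    hθhat n (measurableSet_singleton 0)
  have := fun n θ => isProbabilityMeasure_sampleLaw hf x n θ
  have h0 : Tendsto (fun n => sampleLaw f x n 0 {y | θhat n y = 0}ᶜ) atTop (𝓝 0) := by
    have h := hsparse 0
    simp_rw [r_le_r_zero_iff] at h
    simp_rw [prob_compl_eq_one_sub (hE _)]
    simpa using ENNReal.Tendsto.sub tendsto_const_nhds h (Or.inl ENNReal.one_ne_top)
  have h1 := tendsto_sampleLaw_local_alternative hf x hx s _ (fun n => (hE n).compl) h0
  have h2 := ENNReal.Tendsto.sub (tendsto_const_nhds (x := (1 : ℝ≥0∞))) h1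
    (Or.inl ENNReal.one_ne_top)
  rw [tsub_zero] at h2
  refine h2.congr fun n => ?_
  rw [← prob_compl_eq_one_sub (hE n).compl, compl_compl]

theorem tendsto_maximalRisk {f : ℝ → ℝ} (hf : IsErrorDensity f)
    (x : ℕ → EuclideanSpace ℝ (Fin k)) {Q : Matrix (Fin k) (Fin k) ℝ}
    (hx : Tendsto (fun n : ℕ => designMatrix x n) atTop (𝓝 Q))
    (θhat : (n : ℕ) → (Fin n → ℝ) → EuclideanSpace ℝ (Fin k))
    (hθhat : ∀ n : ℕ, Measurable (θhat n)) (hsparse : SparsityTypeCondition f x θhat)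
    (l : EuclideanSpace ℝ (Fin k) → ℝ) :
    Tendsto (fun n : ℕ => maximalRisk f x θhat l n) atTop
      (𝓝 (⨆ s : EuclideanSpace ℝ (Fin k), ENNReal.ofReal (l s))) := by
  have := fun n θ => isProbabilityMeasure_sampleLaw hf x n θ
  have hupper : ∀ n, maximalRisk f x θhat l n ≤ ⨆ s, ENNReal.ofReal (l s) := by
    intro n
    refine iSup_le fun θ => ?_
    calc _ ≤ ∫⁻ _, (⨆ s, ENNReal.ofReal (l s)) ∂(sampleLaw f x n θ) :=
          lintegral_mono fun y => le_iSup (fun s => ENNReal.ofReal (l s)) _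
      _ = _ := by simp
  refine tendsto_order.2 ⟨fun b hb => ?_, fun b hb => Eventually.of_forall fun n =>
    (hupper n).trans_lt hb⟩
  obtain ⟨s, hs⟩ := lt_iSup_iff.1 hb
  have hlim := ENNReal.Tendsto.const_mul (a := ENNReal.ofReal (l s))
    (tendsto_sampleLaw_estimator_eq_zero hf x hx θhat hθhat hsparse s)
    (Or.inr ENNReal.ofReal_ne_top)
  rw [mul_one] at hlim
  filter_upwards [hlim.eventually (lt_mem_nhds hs), eventually_ge_atTop 1] with n hn hn1
  -- The minus sign in the local alternative makes the scaled error equal to `+s` when the estimator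
  -- is 0.
  refine hn.trans_le (le_trans ?_ (le_iSup _ (-(√n)⁻¹ • s)))
  have hE : MeasurableSet {y | θhat n y = 0} := hθhat n (measurableSet_singleton 0)
  rw [← setLIntegral_const]
  refine (setLIntegral_mono' hE fun y hy => ?_).trans (setLIntegral_le_lintegral _ _)
  have hy' : θhat n y = 0 := hy
  have hn' : √(n : ℝ) ≠ 0 := (Real.sqrt_pos.2 (by positivity)).ne'
  rw [hy', zero_sub, neg_smul, neg_neg, smul_smul, mul_inv_cancel₀ hn', one_smul]

theorem iSup_ofReal_eq_top {α : Type*} {l : α → ℝ} (hl : ¬ BddAbove (range l)) :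
    ⨆ s, ENNReal.ofReal (l s) = ∞ := by
  refine iSup_eq_top.2 fun b hb => ?_
  obtain ⟨_, ⟨s, rfl⟩, hs⟩ := not_bddAbove_iff.1 hl b.toReal
  exact ⟨s, (ENNReal.lt_ofReal_iff_toReal_lt hb.ne).2 hs⟩

theorem not_bddAbove_range_norm_sq {E : Type*} [NormedAddCommGroup E] [NormedSpace ℝ E]
    [Nontrivial E] : ¬ BddAbove (range fun s : E => ‖s‖ ^ 2) := by
  rw [not_bddAbove_iff]
  intro b
  obtain ⟨s, hs⟩ := NormedSpace.exists_lt_norm ℝ E (max b 1)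
  refine ⟨_, ⟨s, rfl⟩, ?_⟩
  have h1 := (le_max_left b 1).trans_lt hs
  have h2 := (le_max_right b 1).trans_lt hs
  show b < ‖s‖ ^ 2
  nlinarith

end SparseRegression

theorem theorem2p1 {k : ℕ} (hk : 1 ≤ k)
    (x : ℕ → EuclideanSpace ℝ (Fin k)) (Q : Matrix (Fin k) (Fin k) ℝ) (hQ : Q.PosDef)
    (hx : Tendsto (fun n : ℕ => SparseRegression.designMatrix x n) atTop (𝓝 Q))
    (f : ℝ → ℝ) (hf : SparseRegression.IsErrorDensity f)
    (θhat : (n : ℕ) → (Fin n → ℝ) → EuclideanSpace ℝ (Fin k))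
    (hθhat : ∀ n : ℕ, Measurable (θhat n))
    (hsparse : SparseRegression.SparsityTypeCondition f x θhat) :
    -- the maximal scaled mean squared error diverges
    Tendsto (fun n : ℕ => ⨆ θ : EuclideanSpace ℝ (Fin k),
        ∫⁻ y, ENNReal.ofReal ((n : ℝ) * ‖θhat n y - θ‖ ^ 2) ∂(SparseRegression.sampleLaw f x n θ))
      atTop (𝓝 ∞) ∧
    -- the maximal risk converges to the supremum of the loss
    (∀ l : EuclideanSpace ℝ (Fin k) → ℝ, (∀ s, 0 ≤ l s) →
      Tendsto (fun n : ℕ => SparseRegression.maximalRisk f x θhat l n) atTop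
        (𝓝 (⨆ s : EuclideanSpace ℝ (Fin k), ENNReal.ofReal (l s)))) ∧
    -- the maximal risk diverges if the loss is unbounded
    (∀ l : EuclideanSpace ℝ (Fin k) → ℝ, (∀ s, 0 ≤ l s) → ¬ BddAbove (Set.range l) →
      Tendsto (fun n : ℕ => SparseRegression.maximalRisk f x θhat l n) atTop (𝓝 ∞)) := by

  have hmain := fun l => SparseRegression.tendsto_maximalRisk hf x hx θhat hθhat hsparse l
  have hunb : ∀ l : EuclideanSpace ℝ (Fin k) → ℝ, ¬ BddAbove (Set.range l) →
      Tendsto (fun n : ℕ => SparseRegression.maximalRisk f x θhat l n) atTop (𝓝 ∞) := by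
    intro l hl
    rw [← SparseRegression.iSup_ofReal_eq_top hl]
    exact hmain l
  refine ⟨?_, fun l _ => hmain l, fun l _ => hunb l⟩
  -- Makes the parameter space nontrivial, so that its squared norm is unbounded.
  have : NeZero k := ⟨by omega⟩
  refine (hunb _ SparseRegression.not_bddAbove_range_norm_sq).congr fun n => ?_
  simp_rw [SparseRegression.maximalRisk, norm_smul, mul_pow, Real.norm_eq_abs, sq_abs,
    Real.sq_sqrt (Nat.cast_nonneg n)]
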